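/- Define rational functions $$\Psi_3(x)=\frac{x^3(3x^2-7)^3(2x^2-7x+7)^3(11x^2-35x+28)^3}{1728\,(x^3-7x+7)^7},\qquad P_3=1-x+\frac{x^3}{7},$$ $$Q_3=\Bigl(1-\frac{3x^2}{7}\Bigr)\Bigl(1-x+\frac{2x^2}{7}\Bigr)\Bigl(1-\frac{5x}{4}+\frac{11x^2}{28}\Bigr),$$ and functions $$Y_0=\sqrt{1-\frac{2x}{3}},\quad Y_1=\left(\frac{21-8x^2+8\sqrt{7-\frac{21}{4}x^2+x^4}}{21+8\sqrt7}\right)^{1/4},\quad Y_2=\left(\frac{21-8x^2-8\sqrt{7-\frac{21}{4}x^2+x^4}}{21-8\sqrt7}\right)^{1/4},$$ where all roots and fractional powers are principal branches near $x=0$ (so that $Y_0=Y_1=Y_2=1$ at $x=0$). Let $${}_3F_2\!\left({a,\,b,\,c\atop d,\,e}\,\Big|\,z\right)=\sum_{n\ge 0}\frac{(a)_n(b)_n(c)_n}{(d)_n(e)_n\,n!}\,z^n .$$ Then there is a neighborhood of $x=0$ in $\mathbb{C}$ on which the three hypergeometric series below converge and the following identities hold: $$P_3^{1/6}\;{}_3F_2\!\left({-\frac1{42},\,\frac5{42},\,\frac{17}{42}\atop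 \frac13,\,\frac23}\,\Big|\,\Psi_3\right)=\frac12\,Y_0+\frac{3+\sqrt7}{12}\,Y_1+\frac{3-\sqrt7}{12}\,Y_2,$$ $$x\,Q_3P_3^{-13/6}\;{}_3F_2\!\left({\frac{13}{42},\,\frac{19}{42},\,\frac{31}{42}\atop \frac23,\,\frac43}\,\Big|\,\Psi_3\right)=-3\,Y_0+\frac{3+\sqrt7}{2}\,Y_1+\frac{3-\sqrt7}{2}\,Y_2,$$ $$x^2Q_3^2P_3^{-9/2}\;{}_3F_2\!\left({\frac9{14},\,\frac{11}{14},\,\frac{15}{14}\atop \frac43,\,\frac53}\,\Big|\,\Psi_3\right)=-2\sqrt7\,Y_1+2\sqrt7\,Y_2.$$ -/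

import Mathlib

open Filter Topology

noncomputable section

namespace DihedralEval

/-- The `n`-th term of the generalized hypergeometric series `₃F₂(a, b, c; d, e; z)`, that is
`(a)ₙ (b)ₙ (c)ₙ / ((d)ₙ (e)ₙ n!) zⁿ` with rising factorials. -/
def hyp32Term (a b c d e z : ℂ) (n : ℕ) : ℂ :=
  ((ascPochhammer ℂ n).eval a * (ascPochhammer ℂ n).eval b * (ascPochhammer ℂ n).eval c) /
    ((ascPochhammer ℂ n).eval d * (ascPochhammer ℂ n).eval e * (n.factorial : ℂ)) * z ^ n

/-- The generalized hypergeometric function `₃F₂(a, b, c; d, e; z)`, as the sum of its series. -/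
def hyp32 (a b c d e z : ℂ) : ℂ := ∑' n : ℕ, hyp32Term a b c d e z n

/-- The rational function `Ψ₃` of degree 21. -/
def Psi3 (x : ℂ) : ℂ :=
  (x ^ 3 * (3 * x ^ 2 - 7) ^ 3 * (2 * x ^ 2 - 7 * x + 7) ^ 3 * (11 * x ^ 2 - 35 * x + 28) ^ 3) /
    (1728 * (x ^ 3 - 7 * x + 7) ^ 7)

/-- The polynomial `P₃`. -/
def P3 (x : ℂ) : ℂ := 1 - x + x ^ 3 / 7

/-- The polynomial `Q₃`. -/
def Q3 (x : ℂ) : ℂ :=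
  (1 - 3 * x ^ 2 / 7) * (1 - x + 2 * x ^ 2 / 7) * (1 - 5 * x / 4 + 11 * x ^ 2 / 28)

/-- The positive square root of `7`, as a complex number. -/
def sqrt7 : ℂ := ((Real.sqrt 7 : ℝ) : ℂ)

/-- `√(7 - 21x²/4 + x⁴)`, principal branch (so its value at `0` is `√7`). -/
def S (x : ℂ) : ℂ := (7 - 21 / 4 * x ^ 2 + x ^ 4) ^ (1 / 2 : ℂ)

/-- The radical function `Y₀`. -/
def Y0 (x : ℂ) : ℂ := (1 - 2 * x / 3) ^ (1 / 2 : ℂ)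

/-- The dihedral function `Y₁`. The quantity under the fourth root is `1` at `x = 0`. -/
def Y1 (x : ℂ) : ℂ := ((21 - 8 * x ^ 2 + 8 * S x) / (21 + 8 * sqrt7)) ^ (1 / 4 : ℂ)

/-- The dihedral function `Y₂`. The quantity under the fourth root is `1` at `x = 0`. -/
def Y2 (x : ℂ) : ℂ := ((21 - 8 * x ^ 2 - 8 * S x) / (21 - 8 * sqrt7)) ^ (1 / 4 : ℂ)

end DihedralEval

end

/-! Both sides of each identity, divided by `P3 ^ (1/6)`, solve one third order linear equation and
have the same 2-jet at `0`.

The equation is the hypergeometric one, written with `θ = z d/dz`, pulled back along `Psi3`: `θ`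
becomes `q d/dx` with `q = Psi3 / Psi3'`. At `z = 0` the local exponents are `0, 1/3, 2/3`, with
solutions `z ^ (j/3)` times a ₃F₂ whose upper parameters are shifted by `j/3`, for `j = 0, 1, 2`.
These are the three series of the theorem. Since `Psi3` vanishes to order exactly `3`, the exponents
at `x = 0` become `0, 1, 2`, and `cubeRootPsi ^ j` replaces `z ^ (j/3)` up to a constant
(`eulerOp_hyp32_comp`).

On the algebraic side, each `Y * P3 ^ (-1/6)` has a logarithmic derivative of the form `(a + c t) /
T - P' / (6 P)` with `t² = T`. Repeated application of `q d/dx + const` therefore stays in pairs of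
polynomials over an explicit denominator, and the equation reduces to integer polynomial identities
decided by `cert` (`IsSolution.eulerOp_eq_zero`).

A solution whose 2-jet vanishes is zero, because the indicial polynomial has roots `0, 1, 2` only
(`eventually_eq_zero_of_eulerOp`). The coefficients of `Y0, Y1, Y2` are then found by matching three
Taylor coefficients (`eq_combination_of_jet`). -/

noncomputable section

namespace DihedralEval

/-! ### Integer polynomials as coefficient lists -/

/-- The value at `x` of the polynomial with coefficient list `l`. -/
def ev : List ℤ → ℂ → ℂ
  | [], _ => 0
  | a :: l, x => a + x * ev l x

/-- Sum of coefficient lists. -/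
def ladd : List ℤ → List ℤ → List ℤ
  | [], m => m
  | a :: l, [] => a :: l
  | a :: l, b :: m => (a + b) :: ladd l m

/-- Scalar multiple of a coefficient list. -/
def lsmul (c : ℤ) : List ℤ → List ℤ
  | [] => []
  | a :: l => c * a :: lsmul c l

/-- Product of coefficient lists. -/
def lmul : List ℤ → List ℤ → List ℤ
  | [], _ => []
  | a :: l, m => ladd (lsmul a m) (0 :: lmul l m)

/-- Power of a coefficient list. -/
def lpow (l : List ℤ) : ℕ → List ℤ
  | 0 => [1]
  | n + 1 => lmul l (lpow l n)

/-- Derivative of a coefficient list. -/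
def lder : List ℤ → List ℤ
  | [] => []
  | _ :: l => ladd l (0 :: lder l)

/-- Whether all coefficients vanish. -/
def lzero : List ℤ → Bool
  | [] => true
  | a :: l => a == 0 && lzero l

theorem ev_ladd (l m : List ℤ) (x : ℂ) : ev (ladd l m) x = ev l x + ev m x := by
  induction l generalizing m with
  | nil => simp [ladd, ev]
  | cons a l ih =>
    cases m with
    | nil => simp [ladd, ev]
    | cons b m => simp only [ladd, ev, ih]; push_cast; ring

theorem ev_lsmul (c : ℤ) (l : List ℤ) (x : ℂ) : ev (lsmul c l) x = c * ev l x := by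
  induction l with
  | nil => simp [lsmul, ev]
  | cons a l ih => simp only [lsmul, ev, ih]; push_cast; ring

theorem ev_lmul (l m : List ℤ) (x : ℂ) : ev (lmul l m) x = ev l x * ev m x := by
  induction l with
  | nil => simp [lmul, ev]
  | cons a l ih => simp only [lmul, ev, ev_ladd, ev_lsmul, ih]; push_cast; ring

theorem ev_lpow (l : List ℤ) (n : ℕ) (x : ℂ) : ev (lpow l n) x = ev l x ^ n := by
  induction n with
  | zero => simp [lpow, ev]
  | succ n ih => rw [lpow, ev_lmul, ih, pow_succ']

theorem ev_of_lzero {l : List ℤ} (h : lzero l = true) (x : ℂ) : ev l x = 0 := by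
  induction l with
  | nil => rfl
  | cons a l ih =>
    simp only [lzero, Bool.and_eq_true, beq_iff_eq] at h
    simp [ev, ih h.2, h.1]

theorem hasDerivAt_ev (l : List ℤ) (x : ℂ) : HasDerivAt (ev l) (ev (lder l) x) x := by
  induction l with
  | nil => exact hasDerivAt_const x 0
  | cons a l ih =>
    have h := ((hasDerivAt_id x).mul ih).const_add (a : ℂ)
    have e : ev (lder (a :: l)) x = 1 * ev l x + id x * ev (lder l) x := by
      simp [lder, ev_ladd, ev]
    rw [e]
    exact h

theorem analyticAt_ev (l : List ℤ) (x : ℂ) : AnalyticAt ℂ (ev l) x :=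
  Complex.analyticAt_iff_eventually_differentiableAt.2
    (Eventually.of_forall fun y => (hasDerivAt_ev l y).differentiableAt)

theorem eventually_ev_ne_zero {l : List ℤ} (h : l.headD 0 ≠ 0) :
    ∀ᶠ x in 𝓝 (0 : ℂ), ev l x ≠ 0 := by
  refine (analyticAt_ev l 0).continuousAt.eventually_ne ?_
  cases l with
  | nil => simp at h
  | cons a l => simpa [ev] using h

/-! ### The covering `Ψ₃` and its logarithmic derivative -/

/-- Coefficients of `x (3x² - 7) (2x² - 7x + 7) (11x² - 35x + 28)`. -/
def lB : List ℤ := lmul [0, -7, 0, 3] (lmul [7, -7, 2] [28, -35, 11])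

/-- Coefficients of `x³ - 7x + 7`. -/
def lP : List ℤ := [7, -7, 0, 1]

/-- Coefficients of `3 B' P - 7 B P'`, whose roots are the double points of `Ψ₃` above `1`. -/
def lK : List ℤ := [-28812, 91238, -108045, 28812, 66885, -85750, 46305, -12348, 1323]

/-- `Ψ₃ / Ψ₃'`, the coefficient of the pullback of the Euler operator `z d/dz` along `Ψ₃`. -/
def qPsi (x : ℂ) : ℂ := ev lB x * ev lP x / ev lK x

-- With `Ψ₃ = B³ / (1728 P⁷)` this gives `Ψ₃' / Ψ₃ = K / (B P)`, hence the formula for `qPsi`.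
set_option maxRecDepth 100000 in
theorem lK_eq (x : ℂ) :
    3 * ev (lder lB) x * ev lP x - 7 * ev lB x * ev (lder lP) x = ev lK x := by
  have h : lzero (ladd (lsmul 3 (lmul (lder lB) lP))
      (ladd (lsmul (-7) (lmul lB (lder lP))) (lsmul (-1) lK))) = true := by decide
  have := ev_of_lzero h x
  simp only [ev_ladd, ev_lsmul, ev_lmul] at this
  push_cast at this
  linear_combination this

/-! ### Symbolic application of the pulled back operator -/

/-- The numerator of the image of `(α + β t) / (84 E²) ^ j * G` under `q d/dx + m / 84`, where
`E = K T`, `t² = T` and `G'/G = (a + c t) / T - P' / (6 P)`. -/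
def step (T a c : List ℤ) (j : ℕ) (m : ℤ) (f : List ℤ × List ℤ) : List ℤ × List ℤ :=
  let E := lmul lK T
  let D := lmul (lsmul 42 lB) (lmul lP T)
  let s := lmul (lsmul 14 lB) (ladd (lsmul 6 (lmul a lP)) (lsmul (-1) (lmul (lder lP) T)))
  let r := lmul (lsmul 84 lB) (lmul c lP)
  let j' : ℤ := -4 * j
  (ladd (lmul D (ladd (lsmul 2 (lmul (lder f.1) E)) (lsmul j' (lmul (lder E) f.1))))
      (lmul E (ladd (lmul E (lsmul m f.1)) (ladd (lmul f.1 s) (lmul T (lmul f.2 r))))),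
    ladd (lmul D (ladd (lsmul 2 (lmul (lder f.2) E))
        (ladd (lmul f.2 (lmul (lder T) lK)) (lsmul j' (lmul (lder E) f.2)))))
      (lmul E (ladd (lmul E (lsmul m f.2)) (ladd (lmul f.1 r) (lmul f.2 s)))))

/-- Three applications of `step`. -/
def step3 (T a c : List ℤ) (u v w : ℤ) : List ℤ × List ℤ :=
  step T a c 2 u (step T a c 1 v (step T a c 0 w ([1], [])))

/-- The decidable certificate that `G` solves the pulled back equation. -/
def cert (T a c : List ℤ) : Bool :=
  let L := step3 T a c 0 (-56) (-28)
  let R := step3 T a c (-2) 10 34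
  let p := lsmul 1728 (lpow lP 7)
  let b := lsmul (-1) (lpow lB 3)
  lzero (ladd (lmul p L.1) (lmul b R.1)) && lzero (ladd (lmul p L.2) (lmul b R.2))

-- Here `Y₀'/Y₀ = -1 / (3 - 2x)`, so the `t` component plays no role and stays zero.
set_option maxRecDepth 100000 in
set_option maxHeartbeats 4000000 in
theorem cert_Y0 : cert [3, -2] [-1] [] = true := by decide

-- Here `T = 4x⁴ - 21x² + 28` and the logarithmic derivative of the fourth root is `-x t / T`. The
-- components along `1` and `t` vanish separately, so one certificate serves both branches `t =
-- ±2S`, that is both `Y1` and `Y2`.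
set_option maxRecDepth 100000 in
set_option maxHeartbeats 4000000 in
theorem cert_Y1 : cert [28, 0, -21, 0, 4] [] [0, -1] = true := by decide

/-! ### Euler operators -/

/-- The first order operator `q d/dx + c`. -/
def euler (q : ℂ → ℂ) (c : ℂ) (f : ℂ → ℂ) (x : ℂ) : ℂ := q x * deriv f x + c * f x

/-- The third order operator `(θ+u)(θ+v)(θ+w) - z (θ+a)(θ+b)(θ+c)` with `θ = q d/dx`. -/
def eulerOp (q z : ℂ → ℂ) (u v w a b c : ℂ) (f : ℂ → ℂ) (x : ℂ) : ℂ :=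
  euler q u (euler q v (euler q w f)) x - z x * euler q a (euler q b (euler q c f)) x

theorem euler_congr {q : ℂ → ℂ} (c : ℂ) {f g : ℂ → ℂ} (h : f =ᶠ[𝓝 0] g) :
    euler q c f =ᶠ[𝓝 0] euler q c g := by
  filter_upwards [h, h.deriv] with x h1 h2
  simp [euler, h1, h2]

theorem eulerOp_congr {q : ℂ → ℂ} (z : ℂ → ℂ) (u v w a b c : ℂ) {f g : ℂ → ℂ} (h : f =ᶠ[𝓝 0] g) :
    eulerOp q z u v w a b c f =ᶠ[𝓝 0] eulerOp q z u v w a b c g := by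
  have key (u v w : ℂ) := euler_congr (q := q) u (euler_congr (q := q) v (euler_congr (q := q) w h))
  filter_upwards [key u v w, key a b c] with x h1 h2
  simp [eulerOp, h1, h2]

theorem analyticAt_euler {q : ℂ → ℂ} (hq : AnalyticAt ℂ q 0) (c : ℂ) {f : ℂ → ℂ}
    (hf : AnalyticAt ℂ f 0) : AnalyticAt ℂ (euler q c f) 0 :=
  (hq.mul hf.deriv).add (analyticAt_const.mul hf)

theorem euler_add_const_mul {q : ℂ → ℂ} (c k : ℂ) {f g : ℂ → ℂ} (hf : AnalyticAt ℂ f 0)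
    (hg : AnalyticAt ℂ g 0) : euler q c (fun x => f x + k * g x) =ᶠ[𝓝 0]
      fun x => euler q c f x + k * euler q c g x := by
  filter_upwards [hf.eventually_analyticAt, hg.eventually_analyticAt] with x h1 h2
  have := (h1.differentiableAt.hasDerivAt.add (h2.differentiableAt.hasDerivAt.const_mul k)).deriv
  have h' : deriv (fun x => f x + k * g x) x = deriv f x + k * deriv g x := this
  simp only [euler, h']
  ring

theorem euler3_add_const_mul {q : ℂ → ℂ} (hq : AnalyticAt ℂ q 0) (u v w k : ℂ) {f g : ℂ → ℂ}
    (hf : AnalyticAt ℂ f 0) (hg : AnalyticAt ℂ g 0) :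
    euler q u (euler q v (euler q w (fun x => f x + k * g x))) =ᶠ[𝓝 0]
      fun x => euler q u (euler q v (euler q w f)) x + k * euler q u (euler q v (euler q w g)) x := by
  have hf1 := analyticAt_euler hq w hf
  have hg1 := analyticAt_euler hq w hg
  refine (euler_congr u (euler_congr v (euler_add_const_mul w k hf hg))).trans ?_
  refine (euler_congr u (euler_add_const_mul v k hf1 hg1)).trans ?_
  exact euler_add_const_mul u k (analyticAt_euler hq v hf1) (analyticAt_euler hq v hg1)

theorem eulerOp_add_const_mul {q : ℂ → ℂ} (hq : AnalyticAt ℂ q 0) (z : ℂ → ℂ) (u v w a b c k : ℂ)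
    {f g : ℂ → ℂ} (hf : AnalyticAt ℂ f 0) (hg : AnalyticAt ℂ g 0)
    (Hf : eulerOp q z u v w a b c f =ᶠ[𝓝 0] 0) (Hg : eulerOp q z u v w a b c g =ᶠ[𝓝 0] 0) :
    eulerOp q z u v w a b c (fun x => f x + k * g x) =ᶠ[𝓝 0] 0 := by
  filter_upwards [Hf, Hg, euler3_add_const_mul hq u v w k hf hg,
    euler3_add_const_mul hq a b c k hf hg] with x h1 h2 h3 h4
  simp only [eulerOp, h3, h4, Pi.zero_apply] at *
  linear_combination h1 + k * h2

/-- Action of `q d/dx + c` on a product of a semi-invariant function and a pullback. -/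
theorem euler_mul_comp {q z W H : ℂ → ℂ} {s : ℂ} (c : ℂ) (hz : AnalyticAt ℂ z 0) (hz0 : z 0 = 0)
    (hqz : ∀ᶠ x in 𝓝 0, q x * deriv z x = z x) (hW : AnalyticAt ℂ W 0)
    (hqW : ∀ᶠ x in 𝓝 0, q x * deriv W x = s * W x) (hH : AnalyticAt ℂ H 0) :
    euler q c (fun x => W x * H (z x)) =ᶠ[𝓝 0] fun x => W x * euler id (c + s) H (z x) := by
  have hzt : Tendsto z (𝓝 0) (𝓝 0) := by simpa [hz0] using hz.continuousAt.tendsto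
  filter_upwards [hz.eventually_analyticAt, hqz, hW.eventually_analyticAt, hqW,
    hzt.eventually hH.eventually_analyticAt] with x h1 h2 h3 h4 h5
  have hc : HasDerivAt (fun x => H (z x)) (deriv H (z x) * deriv z x) x :=
    h5.differentiableAt.hasDerivAt.comp x h1.differentiableAt.hasDerivAt
  have hd : deriv (fun x => W x * H (z x)) x = _ := (h3.differentiableAt.hasDerivAt.mul hc).deriv
  simp only [euler, hd, id]
  linear_combination H (z x) * h4 + W x * deriv H (z x) * h2

/-- An eigenfunction `W` of `q d/dx` with eigenvalue `s` can be pulled out of each factor at the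
price of adding `s` to its constant; what remains is the Euler operator in `z`. -/
theorem eulerOp_mul_comp {q z W H : ℂ → ℂ} {s : ℂ} (u v w a b c : ℂ) (hz : AnalyticAt ℂ z 0)
    (hz0 : z 0 = 0) (hqz : ∀ᶠ x in 𝓝 0, q x * deriv z x = z x) (hW : AnalyticAt ℂ W 0)
    (hqW : ∀ᶠ x in 𝓝 0, q x * deriv W x = s * W x) (hH : AnalyticAt ℂ H 0)
    (h : eulerOp id id (u + s) (v + s) (w + s) (a + s) (b + s) (c + s) H =ᶠ[𝓝 0] 0) :
    eulerOp q z u v w a b c (fun x => W x * H (z x)) =ᶠ[𝓝 0] 0 := by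
  have key (u v w : ℂ) : euler q u (euler q v (euler q w fun x => W x * H (z x))) =ᶠ[𝓝 0]
      fun x => W x * euler id (u + s) (euler id (v + s) (euler id (w + s) H)) (z x) := by
    have h1 := analyticAt_euler (q := id) analyticAt_id (w + s) hH
    refine (euler_congr u (euler_congr v (euler_mul_comp w hz hz0 hqz hW hqW hH))).trans ?_
    refine (euler_congr u (euler_mul_comp v hz hz0 hqz hW hqW h1)).trans ?_
    exact euler_mul_comp u hz hz0 hqz hW hqW (analyticAt_euler analyticAt_id (v + s) h1)
  have hzt : Tendsto z (𝓝 0) (𝓝 0) := by simpa [hz0] using hz.continuousAt.tendsto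
  filter_upwards [key u v w, key a b c, hzt.eventually h] with x h1 h2 h3
  simp only [eulerOp, h1, h2, Pi.zero_apply, id] at *
  linear_combination W x * h3

/-! ### Uniqueness -/

/-- `f` is analytic at `0` with `f 0 = a`, `f' 0 = b`, `f'' 0 = c`. -/
def Jet (f : ℂ → ℂ) (a b c : ℂ) : Prop :=
  AnalyticAt ℂ f 0 ∧ f 0 = a ∧ deriv f 0 = b ∧ deriv (deriv f) 0 = c

theorem Jet.congr {f : ℂ → ℂ} {a b c a' b' c' : ℂ} (h : Jet f a b c) (ha : a = a') (hb : b = b')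
    (hc : c = c') : Jet f a' b' c' := by
  subst ha hb hc
  exact h

theorem deriv_mul_eventuallyEq {f g : ℂ → ℂ} (hf : AnalyticAt ℂ f 0) (hg : AnalyticAt ℂ g 0) :
    deriv (fun x => f x * g x) =ᶠ[𝓝 0] fun x => deriv f x * g x + f x * deriv g x := by
  filter_upwards [hf.eventually_analyticAt, hg.eventually_analyticAt] with x h1 h2
  exact (h1.differentiableAt.hasDerivAt.mul h2.differentiableAt.hasDerivAt).deriv

theorem deriv_add_eventuallyEq {f g : ℂ → ℂ} (hf : AnalyticAt ℂ f 0) (hg : AnalyticAt ℂ g 0) :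
    deriv (fun x => f x + g x) =ᶠ[𝓝 0] fun x => deriv f x + deriv g x := by
  filter_upwards [hf.eventually_analyticAt, hg.eventually_analyticAt] with x h1 h2
  exact (h1.differentiableAt.hasDerivAt.add h2.differentiableAt.hasDerivAt).deriv

theorem Jet.add {f g : ℂ → ℂ} {a b c a' b' c' : ℂ} (hf : Jet f a b c) (hg : Jet g a' b' c') :
    Jet (fun x => f x + g x) (a + a') (b + b') (c + c') := by
  obtain ⟨hf, rfl, rfl, rfl⟩ := hf
  obtain ⟨hg, rfl, rfl, rfl⟩ := hg
  have h := deriv_add_eventuallyEq hf hg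
  exact ⟨hf.add hg, rfl, h.eq_of_nhds,
    h.deriv_eq.trans (deriv_add_eventuallyEq hf.deriv hg.deriv).eq_of_nhds⟩

theorem Jet.mul {f g : ℂ → ℂ} {a b c a' b' c' : ℂ} (hf : Jet f a b c) (hg : Jet g a' b' c') :
    Jet (fun x => f x * g x) (a * a') (b * a' + a * b') (c * a' + 2 * b * b' + a * c') := by
  obtain ⟨hf, rfl, rfl, rfl⟩ := hf
  obtain ⟨hg, rfl, rfl, rfl⟩ := hg
  have h := deriv_mul_eventuallyEq hf hg
  refine ⟨hf.mul hg, rfl, h.eq_of_nhds, h.deriv_eq.trans ?_⟩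
  refine (deriv_add_eventuallyEq (hf.deriv.mul hg) (hf.mul hg.deriv)).eq_of_nhds.trans ?_
  have h1 := (deriv_mul_eventuallyEq hf.deriv hg).eq_of_nhds
  have h2 := (deriv_mul_eventuallyEq hf hg.deriv).eq_of_nhds
  simp only [Pi.mul_def]
  rw [h1, h2]
  ring

theorem jet_const (k : ℂ) : Jet (fun _ => k) k 0 0 := by
  refine ⟨analyticAt_const, rfl, ?_, ?_⟩ <;> simp

theorem jet_id : Jet (fun x => x) 0 1 0 := by
  refine ⟨analyticAt_id, rfl, ?_, ?_⟩ <;> simp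

theorem Jet.const_mul {f : ℂ → ℂ} {a b c : ℂ} (k : ℂ) (hf : Jet f a b c) :
    Jet (fun x => k * f x) (k * a) (k * b) (k * c) := by
  simpa using (jet_const k).mul hf

theorem Jet.comp {f g : ℂ → ℂ} {a b c : ℂ} (hf : Jet f a b c) (hg : Jet g 0 0 0) :
    Jet (fun x => f (g x)) a 0 0 := by
  obtain ⟨hf, rfl, -, -⟩ := hf
  obtain ⟨hg, h0, h1, h2⟩ := hg
  have hgt : Tendsto g (𝓝 0) (𝓝 0) := by simpa [h0] using hg.continuousAt.tendsto
  have hd : deriv (fun x => f (g x)) =ᶠ[𝓝 0] fun x => deriv f (g x) * deriv g x := by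
    filter_upwards [hg.eventually_analyticAt, hgt.eventually hf.eventually_analyticAt] with x h h'
    exact (h'.differentiableAt.hasDerivAt.comp x h.differentiableAt.hasDerivAt).deriv
  have hf0 : AnalyticAt ℂ f (g 0) := by rwa [h0]
  have hfg : AnalyticAt ℂ (fun x => deriv f (g x)) 0 := hf0.deriv.comp hg
  refine ⟨hf0.comp hg, congrArg f h0, by rw [hd.eq_of_nhds, h1, mul_zero], ?_⟩
  rw [hd.deriv_eq, (deriv_mul_eventuallyEq hfg hg.deriv).eq_of_nhds, h1, h2]
  ring

/-- The 2-jet of a solution of `f' = r f`. -/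
theorem jet_of_deriv_eq {f r : ℂ → ℂ} {r1 : ℂ} (hf : AnalyticAt ℂ f 0)
    (h : deriv f =ᶠ[𝓝 0] fun x => r x * f x) (hr : HasDerivAt r r1 0) :
    Jet f (f 0) (r 0 * f 0) ((r1 + r 0 ^ 2) * f 0) := by
  refine ⟨hf, rfl, h.eq_of_nhds, ?_⟩
  have h2 : deriv (fun x => r x * f x) 0 = _ := (hr.mul hf.differentiableAt.hasDerivAt).deriv
  rw [h.deriv_eq, h2, h.eq_of_nhds]
  ring

/-- `q d/dx + c` with `q = x p` preserves divisibility by `xⁿ`. -/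
theorem euler_pow_mul {q p : ℂ → ℂ} (hq : ∀ᶠ x in 𝓝 0, q x = x * p x) (hp : AnalyticAt ℂ p 0)
    (c : ℂ) (n : ℕ) {g : ℂ → ℂ} (hg : AnalyticAt ℂ g 0) :
    ∃ g1 : ℂ → ℂ, AnalyticAt ℂ g1 0 ∧ g1 0 = (n * p 0 + c) * g 0 ∧
      euler q c (fun x => x ^ n * g x) =ᶠ[𝓝 0] fun x => x ^ n * g1 x := by
  refine ⟨fun x => (n * p x + c) * g x + x * p x * deriv g x, ?_, by simp, ?_⟩
  · exact (((analyticAt_const.mul hp).add analyticAt_const).mul hg).add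
      ((analyticAt_id.mul hp).mul hg.deriv)
  · filter_upwards [hq, hg.eventually_analyticAt] with x h1 h2
    have hd : deriv (fun x => x ^ n * g x) x = _ :=
      ((hasDerivAt_pow n x).mul h2.differentiableAt.hasDerivAt).deriv
    simp only [euler, hd, h1]
    rcases n with _ | n
    · simp; ring
    · simp only [Nat.add_sub_cancel, pow_succ]; push_cast; ring

theorem euler3_pow_mul {q p : ℂ → ℂ} (hq : ∀ᶠ x in 𝓝 0, q x = x * p x) (hp : AnalyticAt ℂ p 0)
    (u v w : ℂ) (n : ℕ) {g : ℂ → ℂ} (hg : AnalyticAt ℂ g 0) :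
    ∃ g1 : ℂ → ℂ, AnalyticAt ℂ g1 0 ∧
      g1 0 = (n * p 0 + u) * (n * p 0 + v) * (n * p 0 + w) * g 0 ∧
      euler q u (euler q v (euler q w (fun x => x ^ n * g x))) =ᶠ[𝓝 0] fun x => x ^ n * g1 x := by
  obtain ⟨g1, h1, e1, E1⟩ := euler_pow_mul hq hp w n hg
  obtain ⟨g2, h2, e2, E2⟩ := euler_pow_mul hq hp v n h1
  obtain ⟨g3, h3, e3, E3⟩ := euler_pow_mul hq hp u n h2
  refine ⟨g3, h3, by rw [e3, e2, e1]; ring, ?_⟩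
  exact (euler_congr u ((euler_congr v E1).trans E2)).trans E3

/-- A solution with vanishing 2-jet of an equation with local exponents `0, 1, 2` vanishes. -/
theorem eventually_eq_zero_of_eulerOp {q p z h : ℂ → ℂ} {a b c : ℂ}
    (hq : ∀ᶠ x in 𝓝 0, q x = x * p x) (hp : AnalyticAt ℂ p 0) (hp0 : p 0 = 1 / 3)
    (hz : ContinuousAt z 0) (hz0 : z 0 = 0) (hh : Jet h 0 0 0)
    (H : eulerOp q z 0 (-2 / 3) (-1 / 3) a b c h =ᶠ[𝓝 0] 0) : h =ᶠ[𝓝 0] 0 := by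
  by_contra hne
  -- Factor out the exact order of vanishing, `h = xⁿ g` with `g 0 ≠ 0`; the lowest coefficient of
  -- the equation then constrains `n`.
  obtain ⟨n, g, hg, hg0, hE⟩ := (hh.1.exists_eventuallyEq_pow_smul_nonzero_iff).2 hne
  replace hE : h =ᶠ[𝓝 0] fun x => x ^ n * g x := by
    filter_upwards [hE] with x hx
    simpa using hx
  obtain ⟨L, hL, L0, EL⟩ := euler3_pow_mul hq hp 0 (-2 / 3) (-1 / 3) n hg
  obtain ⟨R, hR, R0, ER⟩ := euler3_pow_mul hq hp a b c n hg
  have hev : ∀ᶠ x in 𝓝[≠] (0 : ℂ), L x - z x * R x = 0 := by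
    have h1 := (eulerOp_congr z 0 (-2 / 3) (-1 / 3) a b c hE).symm.trans H
    filter_upwards [nhdsWithin_le_nhds (h1.and (EL.and ER)), self_mem_nhdsWithin]
      with x ⟨h1, h2, h3⟩ hx
    simp only [eulerOp, h2, h3, Pi.zero_apply] at h1
    have : x ^ n * (L x - z x * R x) = 0 := by linear_combination h1
    exact (mul_eq_zero.1 this).resolve_left (pow_ne_zero n hx)
  have hcont : ContinuousAt (fun x => L x - z x * R x) 0 :=
    hL.continuousAt.sub (hz.mul hR.continuousAt)
  have hlim : L 0 - z 0 * R 0 = 0 :=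
    tendsto_nhds_unique (hcont.tendsto.mono_left nhdsWithin_le_nhds)
      (tendsto_const_nhds.congr' (hev.mono fun x hx => hx.symm))
  rw [L0, hz0, hp0, zero_mul, sub_zero] at hlim
  -- Indicial equation: as `p 0 = 1/3`, the factors are `n/3`, `n/3 - 2/3`, `n/3 - 1/3`, and `27`
  -- clears the denominators. The second half of the operator drops out because `z 0 = 0`.
  have hn : ((n : ℂ) - 0) * (n - 2) * (n - 1) = 0 := by
    have := (mul_eq_zero.1 hlim).resolve_right hg0
    linear_combination 27 * this
  obtain ⟨-, h0, h1, h2⟩ := hh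
  have hJ : Jet g (g 0) (deriv g 0) (deriv (deriv g) 0) := ⟨hg, rfl, rfl, rfl⟩
  have hcases : n = 0 ∨ n = 1 ∨ n = 2 := by
    rcases mul_eq_zero.1 hn with h | h
    · rcases mul_eq_zero.1 h with h | h
      · left; exact_mod_cast (sub_eq_zero.1 h)
      · right; right; exact_mod_cast (sub_eq_zero.1 h)
    · right; left; exact_mod_cast (sub_eq_zero.1 h)
  rcases hcases with rfl | rfl | rfl
  · rw [hE.eq_of_nhds] at h0
    simp [hg0] at h0
  · have := (jet_id.mul hJ).2.2.1
    rw [hE.deriv_eq] at h1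
    simp only [pow_one] at h1
    rw [this] at h1
    simp [hg0] at h1
  · have := ((jet_id.mul jet_id).mul hJ).2.2.2
    rw [hE.deriv.deriv_eq] at h2
    simp only [pow_two] at h2
    rw [this] at h2
    simp [hg0] at h2

/-! ### Power series with geometrically bounded coefficients -/

/-- The coefficients grow at most geometrically. -/
def GeomBdd (c : ℕ → ℂ) : Prop := ∃ C R : ℝ, 0 ≤ C ∧ 1 ≤ R ∧ ∀ n, ‖c n‖ ≤ C * R ^ n

/-- The sum of the power series with coefficients `c`. -/
def psum (c : ℕ → ℂ) (z : ℂ) : ℂ := ∑' n, c n * z ^ n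

/-- The class is stable under Euler operators, since `n ≤ 2ⁿ` lets the linear factor be absorbed by
doubling the rate. -/
theorem GeomBdd.add_mul {c : ℕ → ℂ} (hc : GeomBdd c) (s : ℂ) :
    GeomBdd fun n => (n + s) * c n := by
  obtain ⟨C, R, hC, hR, h⟩ := hc
  refine ⟨(1 + ‖s‖) * C, 2 * R, by positivity, by linarith, fun n => ?_⟩
  have h2 : (n : ℝ) ≤ 2 ^ n := by exact_mod_cast Nat.lt_two_pow_self.le
  have h1 : (1 : ℝ) ≤ 2 ^ n := one_le_pow₀ (by norm_num)
  have hs : ‖(n : ℂ) + s‖ ≤ (1 + ‖s‖) * 2 ^ n := by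
    refine (norm_add_le _ _).trans ?_
    rw [Complex.norm_natCast]
    nlinarith [norm_nonneg s]
  calc ‖((n : ℂ) + s) * c n‖ ≤ ((1 + ‖s‖) * 2 ^ n) * (C * R ^ n) := by
        rw [norm_mul]; exact mul_le_mul hs (h n) (norm_nonneg _) (by positivity)
    _ = (1 + ‖s‖) * C * (2 * R) ^ n := by rw [mul_pow]; ring

/-- The radius `1 / (4R)` spends one factor `2` on `n ≤ 2ⁿ` and keeps another for a geometric series
of ratio `1/2`. -/
theorem norm_deriv_term_le {c : ℕ → ℂ} {C R : ℝ} (hC : 0 ≤ C) (hR : 0 < R)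
    (h : ∀ n, ‖c n‖ ≤ C * R ^ n) (n : ℕ) {z : ℂ} (hz : ‖z‖ < 1 / (4 * R)) :
    ‖c n * (n * z ^ (n - 1))‖ ≤ 4 * R * C * (1 / 2 : ℝ) ^ n := by
  rcases n with _ | n
  · simp only [Nat.cast_zero, zero_mul, mul_zero, norm_zero]
    positivity
  · have h2 : ((n + 1 : ℕ) : ℝ) ≤ 2 ^ (n + 1) := by exact_mod_cast Nat.lt_two_pow_self.le
    have h3 : ‖z‖ ^ n ≤ (1 / (4 * R)) ^ n := pow_le_pow_left₀ (norm_nonneg z) hz.le n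
    have e : R ^ (n + 1) * (2 ^ (n + 1) * (1 / (4 * R)) ^ n) = 4 * R * (1 / 2 : ℝ) ^ (n + 1) := by
      have e1 : (R * (2 * (1 / (4 * R)))) ^ n = (1 / 2 : ℝ) ^ n := by
        congr 1
        field_simp
        norm_num
      rw [mul_pow, mul_pow] at e1
      rw [pow_succ, pow_succ, pow_succ, ← e1]
      ring
    rw [norm_mul, norm_mul, norm_pow, Complex.norm_natCast, Nat.add_sub_cancel]
    calc ‖c (n + 1)‖ * (((n + 1 : ℕ) : ℝ) * ‖z‖ ^ n)
        ≤ (C * R ^ (n + 1)) * (2 ^ (n + 1) * (1 / (4 * R)) ^ n) := by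
          refine mul_le_mul (h _) (mul_le_mul h2 h3 (by positivity) (by positivity))
            (by positivity) (by positivity)
      _ = 4 * R * C * (1 / 2 : ℝ) ^ (n + 1) := by linear_combination C * e

theorem GeomBdd.eventually_hasDerivAt {c : ℕ → ℂ} (hc : GeomBdd c) :
    ∀ᶠ z in 𝓝 (0 : ℂ), (Summable fun n => c n * z ^ n) ∧
      (Summable fun n => c n * (n * z ^ (n - 1))) ∧
      HasDerivAt (psum c) (∑' n, c n * (n * z ^ (n - 1))) z := by
  obtain ⟨C, R, hC, hR, h⟩ := hc
  obtain ⟨r, hrR⟩ : ∃ r, r = 1 / (4 * R) := ⟨_, rfl⟩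
  have hr : 0 < r := by rw [hrR]; positivity
  obtain ⟨u, hu, hb⟩ : ∃ u : ℕ → ℝ, Summable u ∧
      ∀ n, ∀ z ∈ Metric.ball (0 : ℂ) r, ‖c n * (n * z ^ (n - 1))‖ ≤ u n := by
    refine ⟨fun n => 4 * R * C * (1 / 2 : ℝ) ^ n,
      (summable_geometric_of_lt_one (by norm_num) (by norm_num)).mul_left _, fun n z hz => ?_⟩
    rw [mem_ball_zero_iff, hrR] at hz
    exact norm_deriv_term_le hC (by linarith) h n hz
  -- Termwise differentiation needs convergence at one base point; the centre is chosen.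
  have h0 : Summable fun n => c n * (0 : ℂ) ^ n :=
    summable_of_ne_finset_zero (s := {0}) fun n hn => by
      have : n ≠ 0 := by simpa using hn
      simp [this]
  have hd (n : ℕ) (z : ℂ) (_ : z ∈ Metric.ball (0 : ℂ) r) :
      HasDerivAt (fun z => c n * z ^ n) (c n * (n * z ^ (n - 1))) z :=
    (hasDerivAt_pow n z).const_mul (c n)
  have hpre := (convex_ball (0 : ℂ) r).isPreconnected
  filter_upwards [Metric.ball_mem_nhds (0 : ℂ) hr] with z hz
  have h1 : Summable fun n => c n * z ^ n :=
    summable_of_summable_hasDerivAt_of_isPreconnected (g := fun n z => c n * z ^ n)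
      (g' := fun n z => c n * (n * z ^ (n - 1))) hu Metric.isOpen_ball hpre hd hb
      (Metric.mem_ball_self hr) h0 hz
  have h2 : HasDerivAt (fun z => ∑' n, c n * z ^ n) (∑' n, c n * (n * z ^ (n - 1))) z :=
    hasDerivAt_tsum_of_isPreconnected (g := fun n z => c n * z ^ n)
      (g' := fun n z => c n * (n * z ^ (n - 1))) hu Metric.isOpen_ball hpre hd hb
      (Metric.mem_ball_self hr) h0 hz
  exact ⟨h1, .of_norm_bounded hu fun n => hb n z hz, h2⟩

theorem GeomBdd.analyticAt_psum {c : ℕ → ℂ} (hc : GeomBdd c) : AnalyticAt ℂ (psum c) 0 :=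
  Complex.analyticAt_iff_eventually_differentiableAt.2
    (hc.eventually_hasDerivAt.mono fun _ h => h.2.2.differentiableAt)

theorem GeomBdd.euler_psum {c : ℕ → ℂ} (hc : GeomBdd c) (s : ℂ) :
    euler id s (psum c) =ᶠ[𝓝 0] psum fun n => (n + s) * c n := by
  filter_upwards [hc.eventually_hasDerivAt] with z ⟨h1, h2, h3⟩
  rw [euler, h3.deriv, id, psum, psum, ← tsum_mul_left, ← tsum_mul_left,
    ← (h2.mul_left z).tsum_add (h1.mul_left s)]
  refine tsum_congr fun n => ?_
  rcases n with _ | n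
  · simp
  · rw [Nat.add_sub_cancel, pow_succ]; ring

theorem GeomBdd.euler3_psum {c : ℕ → ℂ} (hc : GeomBdd c) (u v w : ℂ) :
    euler id u (euler id v (euler id w (psum c))) =ᶠ[𝓝 0]
      psum fun n => (n + u) * ((n + v) * ((n + w) * c n)) := by
  have h1 := hc.add_mul w
  have h2 := h1.add_mul v
  exact (euler_congr u ((euler_congr v (hc.euler_psum w)).trans (h1.euler_psum v))).trans
    (h2.euler_psum u)

/-! ### The hypergeometric series -/

/-- Coefficients of the hypergeometric series. -/
def hypCoeff (a b c d e : ℂ) (n : ℕ) : ℂ :=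
  ((ascPochhammer ℂ n).eval a * (ascPochhammer ℂ n).eval b * (ascPochhammer ℂ n).eval c) /
    ((ascPochhammer ℂ n).eval d * (ascPochhammer ℂ n).eval e * (n.factorial : ℂ))

theorem hyp32_eq_psum (a b c d e : ℂ) : hyp32 a b c d e = psum (hypCoeff a b c d e) := rfl

theorem norm_add_natCast_ge {d : ℂ} (n : ℕ) : d.re + n ≤ ‖d + n‖ := by
  simpa using Complex.re_le_norm (d + n)

theorem add_natCast_ne_zero {d : ℂ} (hd : 0 < d.re) (n : ℕ) : d + n ≠ 0 := by
  intro h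
  have := norm_add_natCast_ge (d := d) n
  rw [h, norm_zero] at this
  have : (0 : ℝ) ≤ n := n.cast_nonneg
  linarith

theorem ascPochhammer_eval_ne_zero {d : ℂ} (hd : 0 < d.re) (n : ℕ) :
    (ascPochhammer ℂ n).eval d ≠ 0 := by
  induction n with
  | zero => simp
  | succ n ih => rw [ascPochhammer_succ_eval]; exact mul_ne_zero ih (add_natCast_ne_zero hd n)

theorem hypCoeff_succ (a b c : ℂ) {d e : ℂ} (hd : 0 < d.re) (he : 0 < e.re) (n : ℕ) :
    (n + 1) * (d + n) * (e + n) * hypCoeff a b c d e (n + 1) =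
      (a + n) * (b + n) * (c + n) * hypCoeff a b c d e n := by
  have h1 := ascPochhammer_eval_ne_zero hd n
  have h2 := ascPochhammer_eval_ne_zero he n
  have h3 := add_natCast_ne_zero hd n
  have h4 := add_natCast_ne_zero he n
  have h5 : (n.factorial : ℂ) ≠ 0 := by exact_mod_cast n.factorial_ne_zero
  have h6 : (n : ℂ) + 1 ≠ 0 := by exact_mod_cast n.succ_ne_zero
  simp only [hypCoeff, ascPochhammer_succ_eval, Nat.factorial_succ]
  push_cast
  field_simp

/-- The ratio of consecutive coefficients is bounded: each factor `a + n` is at most, and each `d +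
n` at least, a constant times `n + 1`, so the cubes of `n + 1` cancel. The exact radius of
convergence is not needed. -/
theorem geomBdd_hypCoeff (a b c : ℂ) {d e : ℂ} (hd : 0 < d.re) (he : 0 < e.re) :
    GeomBdd (hypCoeff a b c d e) := by
  have up (a : ℂ) (n : ℕ) : ‖a + n‖ ≤ (1 + ‖a‖) * (n + 1) := by
    refine (norm_add_le _ _).trans ?_
    rw [Complex.norm_natCast]
    nlinarith [norm_nonneg a, (n.cast_nonneg : (0 : ℝ) ≤ n)]
  have low (d : ℂ) (n : ℕ) : min d.re 1 * (n + 1) ≤ ‖d + n‖ := by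
    refine le_trans ?_ (norm_add_natCast_ge n)
    nlinarith [min_le_left d.re 1, min_le_right d.re 1, (n.cast_nonneg : (0 : ℝ) ≤ n)]
  set A := (1 + ‖a‖) * (1 + ‖b‖) * (1 + ‖c‖) with hA
  set D := min d.re 1 * min e.re 1 with hD
  have hd1 : 0 < min d.re 1 := lt_min hd one_pos
  have he1 : 0 < min e.re 1 := lt_min he one_pos
  have hDpos : 0 < D := mul_pos hd1 he1
  have hApos : 0 ≤ A := by positivity
  have hstep (n : ℕ) : ‖hypCoeff a b c d e (n + 1)‖ ≤ (1 + A / D) * ‖hypCoeff a b c d e n‖ := by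
    have h := congrArg norm (hypCoeff_succ a b c hd he n)
    have hn : ‖(n : ℂ) + 1‖ = n + 1 := by
      rw [← Nat.cast_add_one, Complex.norm_natCast]; push_cast; rfl
    simp only [norm_mul, hn] at h
    have hn0 : (0 : ℝ) < n + 1 := by positivity
    set x := ‖hypCoeff a b c d e (n + 1)‖ with hx
    set y := ‖hypCoeff a b c d e n‖ with hy
    have hx0 : 0 ≤ x := norm_nonneg _
    have hy0 : 0 ≤ y := norm_nonneg _
    have h1 : ((n : ℝ) + 1) ^ 3 * (D * x) ≤ ((n : ℝ) + 1) ^ 3 * (A * y) :=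
      calc ((n : ℝ) + 1) ^ 3 * (D * x)
          = (n + 1) * (min d.re 1 * (n + 1)) * (min e.re 1 * (n + 1)) * x := by rw [hD]; ring
        _ ≤ (n + 1) * ‖d + n‖ * ‖e + n‖ * x := by
            gcongr
            · exact low d n
            · exact low e n
        _ = ‖a + n‖ * ‖b + n‖ * ‖c + n‖ * y := h
        _ ≤ ((1 + ‖a‖) * (n + 1)) * ((1 + ‖b‖) * (n + 1)) * ((1 + ‖c‖) * (n + 1)) * y := by
            gcongr
            · exact up a n
            · exact up b n
            · exact up c n
        _ = ((n : ℝ) + 1) ^ 3 * (A * y) := by rw [hA]; ring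
    have h2 : D * x ≤ A * y := le_of_mul_le_mul_left h1 (by positivity)
    have h3 : x ≤ A / D * y := by
      rw [div_mul_eq_mul_div, le_div_iff₀ hDpos]; linarith
    nlinarith
  refine ⟨‖hypCoeff a b c d e 0‖, 1 + A / D, norm_nonneg _, ?_, fun n => ?_⟩
  · have : 0 ≤ A / D := by positivity
    linarith
  · induction n with
    | zero => simp
    | succ n ih =>
      refine (hstep n).trans ?_
      rw [pow_succ]
      have : 0 ≤ 1 + A / D := by positivity
      nlinarith [mul_le_mul_of_nonneg_left ih this]

theorem hyp32_zero (a b c d e : ℂ) : hyp32 a b c d e 0 = 1 := by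
  rw [hyp32, tsum_eq_single 0]
  · simp [hyp32Term]
  · intro n hn
    simp [hyp32Term, hn]

/-- The hypergeometric differential equation. -/
theorem eulerOp_hyp32 {a b c d e u v w : ℂ} (hd : 0 < d.re) (he : 0 < e.re)
    (h : ∀ n : ℂ, (n + u) * (n + v) * (n + w) = n * (n + (d - 1)) * (n + (e - 1))) :
    eulerOp id id u v w a b c (hyp32 a b c d e) =ᶠ[𝓝 0] 0 := by
  have hc := geomBdd_hypCoeff a b c hd he
  rw [hyp32_eq_psum]
  filter_upwards [hc.euler3_psum u v w, hc.euler3_psum a b c,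
    (((hc.add_mul w).add_mul v).add_mul u).eventually_hasDerivAt] with z h1 h2 h3
  rw [eulerOp, h1, h2, psum, psum, h3.1.tsum_eq_zero_add, id, ← tsum_mul_left]
  -- The constant term vanishes because `h` at `0` gives `u v w = 0`; the series can then be shifted
  -- by one and compared through the coefficient recurrence.
  have h0 : ((0 : ℕ) + u) * (((0 : ℕ) + v) * (((0 : ℕ) + w) * hypCoeff a b c d e 0)) = 0 := by
    have := h 0
    push_cast
    linear_combination hypCoeff a b c d e 0 * this
  rw [h0, zero_mul, zero_add, Pi.zero_apply, sub_eq_zero]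
  refine tsum_congr fun n => ?_
  have h4 := h (n + 1)
  have h5 := hypCoeff_succ a b c hd he n
  push_cast
  rw [pow_succ]
  linear_combination (hypCoeff a b c d e (n + 1) * z ^ n * z) * h4 + z ^ n * z * h5

/-! ### Correctness of the symbolic computation -/

/-- The function `(α + β t) / (84 E²) ^ j * G` with `E = K T`. -/
def rep (T : List ℤ) (t G : ℂ → ℂ) (j : ℕ) (f : List ℤ × List ℤ) (x : ℂ) : ℂ :=
  (ev f.1 x + ev f.2 x * t x) / (84 * ev (lmul lK T) x ^ 2) ^ j * G x

/-- `t² = T` and `G'/G = (a + c t) / T - P' / (6 P)` near `0`. -/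
structure IsSolution (T a c : List ℤ) (t G : ℂ → ℂ) : Prop where
  ne_zero : T.headD 0 ≠ 0
  sq : ∀ᶠ x in 𝓝 0, t x ^ 2 = ev T x
  deriv_t : ∀ᶠ x in 𝓝 0, HasDerivAt t (ev (lder T) x * t x / (2 * ev T x)) x
  deriv_G : ∀ᶠ x in 𝓝 0, HasDerivAt G
    (((ev a x + ev c x * t x) / ev T x - ev (lder lP) x / (6 * ev lP x)) * G x) x

theorem hasDerivAt_div_pow {f D : ℂ → ℂ} {f' D' x : ℂ} (hf : HasDerivAt f f' x)
    (hD : HasDerivAt D D' x) (h0 : D x ≠ 0) (j : ℕ) :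
    HasDerivAt (fun x => f x / D x ^ j) ((f' * D x - j * f x * D') / D x ^ (j + 1)) x := by
  have h := hf.div (hD.pow j) (pow_ne_zero j h0)
  refine h.congr_deriv ?_
  simp only [Pi.pow_apply]
  rcases j with _ | j
  · field_simp
    simp
  · rw [Nat.add_sub_cancel]
    field_simp
    ring

/-- Differentiation preserves the span of `1` and `t` over rational functions, as `t' = T' t /
(2T)`. Multiplying by `84 E²` clears `K`, `T` and the rational constants, which is why the
denominator exponent rises by one. -/
theorem IsSolution.euler_rep {T a c : List ℤ} {t G : ℂ → ℂ} (h : IsSolution T a c t G) (j : ℕ)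
    (m : ℤ) (f : List ℤ × List ℤ) :
    euler qPsi (m / 84) (rep T t G j f) =ᶠ[𝓝 0] rep T t G (j + 1) (step T a c j m f) := by
  have hK : ∀ᶠ x in 𝓝 (0 : ℂ), ev lK x ≠ 0 := eventually_ev_ne_zero (by decide)
  have hP : ∀ᶠ x in 𝓝 (0 : ℂ), ev lP x ≠ 0 := eventually_ev_ne_zero (by decide)
  filter_upwards [hK, hP, eventually_ev_ne_zero h.ne_zero, h.sq, h.deriv_t, h.deriv_G]
    with x hK hP hT hsq ht hG
  have hE0 : ev (lmul lK T) x ≠ 0 := by rw [ev_lmul]; exact mul_ne_zero hK hT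
  have hN := (hasDerivAt_ev f.1 x).add ((hasDerivAt_ev f.2 x).mul ht)
  have hD : HasDerivAt (fun x => 84 * ev (lmul lK T) x ^ 2) _ x :=
    ((hasDerivAt_ev (lmul lK T) x).pow 2).const_mul 84
  have hD0 : 84 * ev (lmul lK T) x ^ 2 ≠ 0 := mul_ne_zero (by norm_num) (pow_ne_zero 2 hE0)
  have hd : deriv (rep T t G j f) x = _ := ((hasDerivAt_div_pow hN hD hD0 j).mul hG).deriv
  rw [euler, hd]
  simp only [rep, step, ev_ladd, ev_lsmul, ev_lmul, qPsi, Pi.add_apply, Pi.mul_apply] at hE0 hD0 ⊢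
  generalize ev (lder (lmul lK T)) x = E'
  generalize ev (lder lP) x = P'
  generalize ev (lder T) x = T' at *
  generalize ev (lder f.1) x = α'
  generalize ev (lder f.2) x = β'
  generalize ev f.1 x = α
  generalize ev f.2 x = β
  generalize ev lB x = B
  generalize ev lK x = K at *
  generalize ev lP x = P at *
  -- Eliminating `T` in favour of `s²` leaves a rational identity in independent variables.
  rw [← hsq] at hT hE0 hD0 ⊢
  generalize t x = s at *
  generalize ev a x = a'
  generalize ev c x = c'
  generalize G x = g
  have hs : s ≠ 0 := by rintro rfl; simp at hT
  push_cast
  simp only [pow_succ (84 * (K * s ^ 2) ^ 2) j]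
  have hDj : (84 * (K * s ^ 2) ^ 2) ^ j ≠ 0 := pow_ne_zero j hD0
  generalize (84 * (K * s ^ 2) ^ 2) ^ j = Dj at *
  field_simp
  ring

theorem IsSolution.euler3_rep {T a c : List ℤ} {t G : ℂ → ℂ} (h : IsSolution T a c t G)
    (u v w : ℤ) :
    euler qPsi (u / 84) (euler qPsi (v / 84) (euler qPsi (w / 84) G)) =ᶠ[𝓝 0]
      rep T t G 3 (step3 T a c u v w) := by
  have h0 : G = rep T t G 0 ([1], []) := by
    funext x
    simp [rep, ev]
  have h1 : euler qPsi (w / 84) G =ᶠ[𝓝 0] rep T t G 1 (step T a c 0 w ([1], [])) := by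
    conv_lhs => rw [h0]
    exact h.euler_rep 0 w _
  exact (euler_congr _ ((euler_congr _ h1).trans (h.euler_rep 1 v _))).trans (h.euler_rep 2 u _)

theorem Psi3_eq (x : ℂ) : Psi3 x = ev lB x ^ 3 / (1728 * ev lP x ^ 7) := by
  have h1 : x ^ 3 * (3 * x ^ 2 - 7) ^ 3 * (2 * x ^ 2 - 7 * x + 7) ^ 3 *
      (11 * x ^ 2 - 35 * x + 28) ^ 3 = ev lB x ^ 3 := by
    simp only [lB, ev_lmul, ev]
    push_cast
    ring
  have h2 : x ^ 3 - 7 * x + 7 = ev lP x := by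
    simp only [lP, ev]
    push_cast
    ring
  rw [Psi3, h1, h2]

theorem IsSolution.eulerOp_eq_zero {T a c : List ℤ} {t G : ℂ → ℂ} (h : IsSolution T a c t G)
    (hc : cert T a c = true) :
    eulerOp qPsi Psi3 0 (-2 / 3) (-1 / 3) (-1 / 42) (5 / 42) (17 / 42) G =ᶠ[𝓝 0] 0 := by
  have hP : ∀ᶠ x in 𝓝 (0 : ℂ), ev lP x ≠ 0 := eventually_ev_ne_zero (by decide)
  simp only [cert, Bool.and_eq_true] at hc
  have hL := h.euler3_rep 0 (-56) (-28)
  have hR := h.euler3_rep (-2) 10 34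
  rw [show (((0 : ℤ) : ℂ) / 84) = 0 by norm_num, show (((-56 : ℤ) : ℂ) / 84) = -2 / 3 by norm_num,
    show (((-28 : ℤ) : ℂ) / 84) = -1 / 3 by norm_num] at hL
  rw [show (((-2 : ℤ) : ℂ) / 84) = -1 / 42 by norm_num,
    show (((10 : ℤ) : ℂ) / 84) = 5 / 42 by norm_num,
    show (((34 : ℤ) : ℂ) / 84) = 17 / 42 by norm_num] at hR
  filter_upwards [hL, hR, hP] with x h1 h2 h3
  have e1 := ev_of_lzero hc.1 x
  have e2 := ev_of_lzero hc.2 x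
  simp only [ev_ladd, ev_lmul, ev_lsmul, ev_lpow] at e1 e2
  push_cast at e1 e2
  rw [eulerOp, h1, h2, Pi.zero_apply, Psi3_eq, rep, rep]
  generalize step3 T a c 0 (-56) (-28) = L at *
  generalize step3 T a c (-2) 10 34 = R at *
  generalize (84 * ev (lmul lK T) x ^ 2) ^ 3 = D
  have e : 1728 * ev lP x ^ 7 * (ev L.1 x + ev L.2 x * t x) -
      ev lB x ^ 3 * (ev R.1 x + ev R.2 x * t x) = 0 := by
    linear_combination e1 + t x * e2
  have e' : (ev L.1 x + ev L.2 x * t x) =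
      ev lB x ^ 3 / (1728 * ev lP x ^ 7) * (ev R.1 x + ev R.2 x * t x) := by
    field_simp
    linear_combination e
  rw [e']
  ring

/-! ### The covering near `0` -/

theorem P3_eq (x : ℂ) : P3 x = ev lP x / 7 := by
  simp only [P3, lP, ev]
  push_cast
  ring

/-- The constant is the product `-7 · 7 · 28` of the constant terms of the three quadratic factors.
-/
theorem mul_Q3_eq (x : ℂ) : x * Q3 x = -ev lB x / 1372 := by
  simp only [Q3, lB, ev_lmul, ev]
  push_cast
  ring

theorem hasDerivAt_P3 (x : ℂ) : HasDerivAt P3 (ev (lder lP) x / 7) x := by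
  have h : P3 = fun x => ev lP x / 7 := funext P3_eq
  rw [h]
  exact (hasDerivAt_ev lP x).div_const 7

theorem hasDerivAt_mul_Q3 (x : ℂ) :
    HasDerivAt (fun x => x * Q3 x) (-ev (lder lB) x / 1372) x := by
  have h : (fun x => x * Q3 x) = fun x => -ev lB x / 1372 := funext mul_Q3_eq
  rw [h]
  exact (hasDerivAt_ev lB x).neg.div_const 1372

theorem eventually_lP_ne_zero : ∀ᶠ x in 𝓝 (0 : ℂ), ev lP x ≠ 0 :=
  eventually_ev_ne_zero (by decide)

theorem eventually_lK_ne_zero : ∀ᶠ x in 𝓝 (0 : ℂ), ev lK x ≠ 0 :=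
  eventually_ev_ne_zero (by decide)

theorem Psi3_zero : Psi3 0 = 0 := by simp [Psi3]

theorem analyticAt_Psi3 : AnalyticAt ℂ Psi3 0 := by
  have h : Psi3 = fun x => ev lB x ^ 3 / (1728 * ev lP x ^ 7) := funext Psi3_eq
  rw [h]
  refine ((analyticAt_ev lB 0).pow 3).div (analyticAt_const.mul ((analyticAt_ev lP 0).pow 7)) ?_
  simp [lP, ev]

theorem qPsi_mul_deriv_Psi3 : ∀ᶠ x in 𝓝 0, qPsi x * deriv Psi3 x = Psi3 x := by
  filter_upwards [eventually_lP_ne_zero, eventually_lK_ne_zero] with x hP hK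
  have h : Psi3 = fun x => ev lB x ^ 3 / (1728 * ev lP x ^ 7) := funext Psi3_eq
  have hd := ((hasDerivAt_ev lB x).pow 3).div
    (((hasDerivAt_ev lP x).pow 7).const_mul 1728) (by simpa using hP)
  have hd' := hd.congr_of_eventuallyEq (f₁ := Psi3) (Eventually.of_forall fun y => congrFun h y)
  rw [hd'.deriv, qPsi, Psi3_eq]
  simp only [Pi.pow_apply]
  have e := lK_eq x
  field_simp
  push_cast
  linear_combination (ev lB x ^ 3 * ev lP x ^ 6) * e

theorem qPsi_eq (x : ℂ) :
    qPsi x = x * (ev (lmul [-7, 0, 3] (lmul [7, -7, 2] [28, -35, 11])) x * ev lP x / ev lK x) := by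
  simp only [qPsi, lB, ev_lmul, ev]
  push_cast
  ring

theorem analyticAt_qPsi_div : AnalyticAt ℂ
    (fun x => ev (lmul [-7, 0, 3] (lmul [7, -7, 2] [28, -35, 11])) x * ev lP x / ev lK x) 0 :=
  ((analyticAt_ev _ 0).mul (analyticAt_ev _ 0)).div (analyticAt_ev _ 0) (by simp [lK, ev])

theorem analyticAt_qPsi : AnalyticAt ℂ qPsi 0 :=
  ((analyticAt_ev _ 0).mul (analyticAt_ev _ 0)).div (analyticAt_ev _ 0) (by simp [lK, ev])

/-- Logarithmic derivative of a power. -/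
theorem hasDerivAt_cpow_const {u : ℂ → ℂ} {u' x : ℂ} (c : ℂ) (hu : HasDerivAt u u' x)
    (hx : u x ∈ Complex.slitPlane) :
    HasDerivAt (fun x => u x ^ c) (c * u' / u x * u x ^ c) x := by
  refine (hu.cpow_const hx).congr_deriv ?_
  have h0 := Complex.slitPlane_ne_zero hx
  rw [Complex.cpow_sub _ _ h0, Complex.cpow_one]
  field_simp

theorem eventually_mem_slitPlane {u : ℂ → ℂ} (hu : ContinuousAt u 0)
    (h0 : u 0 ∈ Complex.slitPlane) : ∀ᶠ x in 𝓝 0, u x ∈ Complex.slitPlane :=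
  hu.eventually (Complex.isOpen_slitPlane.mem_nhds h0)

theorem analyticAt_cpow_const {u : ℂ → ℂ} (c : ℂ) (hu : AnalyticAt ℂ u 0)
    (h0 : u 0 ∈ Complex.slitPlane) : AnalyticAt ℂ (fun x => u x ^ c) 0 :=
  hu.cpow analyticAt_const h0

theorem P3_zero : P3 0 = 1 := by simp [P3]

theorem P3_zero_mem : P3 0 ∈ Complex.slitPlane := by
  rw [P3_zero]; exact Complex.one_mem_slitPlane

theorem analyticAt_P3 : AnalyticAt ℂ P3 0 :=
  Complex.analyticAt_iff_eventually_differentiableAt.2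
    (Eventually.of_forall fun x => (hasDerivAt_P3 x).differentiableAt)

theorem eventually_hasDerivAt_P3_cpow (c : ℂ) : ∀ᶠ x in 𝓝 0,
    HasDerivAt (fun x => P3 x ^ c) (c * ev (lder lP) x / ev lP x * P3 x ^ c) x := by
  filter_upwards [eventually_mem_slitPlane analyticAt_P3.continuousAt P3_zero_mem,
    eventually_lP_ne_zero] with x hx hP
  refine (hasDerivAt_cpow_const c (hasDerivAt_P3 x) hx).congr_deriv ?_
  rw [P3_eq x]
  field_simp

theorem analyticAt_P3_cpow (c : ℂ) : AnalyticAt ℂ (fun x => P3 x ^ c) 0 :=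
  analyticAt_cpow_const c analyticAt_P3 P3_zero_mem

/-- The cube root of `-27 Ψ₃ / 49` that is `x + O(x²)`. -/
def cubeRootPsi (x : ℂ) : ℂ := x * Q3 x * P3 x ^ (-7 / 3 : ℂ)

theorem analyticAt_mul_Q3 : AnalyticAt ℂ (fun x => x * Q3 x) 0 :=
  Complex.analyticAt_iff_eventually_differentiableAt.2
    (Eventually.of_forall fun x => (hasDerivAt_mul_Q3 x).differentiableAt)

theorem analyticAt_cubeRootPsi : AnalyticAt ℂ cubeRootPsi 0 :=
  analyticAt_mul_Q3.mul (analyticAt_P3_cpow _)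

theorem qPsi_mul_deriv_cubeRootPsi :
    ∀ᶠ x in 𝓝 0, qPsi x * deriv cubeRootPsi x = 1 / 3 * cubeRootPsi x := by
  filter_upwards [eventually_lP_ne_zero, eventually_lK_ne_zero,
    eventually_hasDerivAt_P3_cpow (-7 / 3)] with x hP hK hd
  have h : deriv cubeRootPsi x = _ := ((hasDerivAt_mul_Q3 x).mul hd).deriv
  rw [h, cubeRootPsi, qPsi, mul_Q3_eq]
  have e := lK_eq x
  field_simp
  linear_combination (-P3 x ^ (-(7 / 3) : ℂ) * ev lB x) * e

theorem qPsi_mul_deriv_cubeRootPsi_pow (j : ℕ) :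
    ∀ᶠ x in 𝓝 0, qPsi x * deriv (fun x => cubeRootPsi x ^ j) x = j / 3 * cubeRootPsi x ^ j := by
  filter_upwards [qPsi_mul_deriv_cubeRootPsi,
    analyticAt_cubeRootPsi.eventually_analyticAt] with x h1 h2
  have h : deriv (fun x => cubeRootPsi x ^ j) x = _ :=
    (h2.differentiableAt.hasDerivAt.pow j).deriv
  rw [h]
  rcases j with _ | j
  · simp
  · rw [Nat.add_sub_cancel, pow_succ]
    linear_combination ((j + 1 : ℕ) : ℂ) * cubeRootPsi x ^ j * h1

/-! ### The hypergeometric side -/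

theorem analyticAt_hyp32 (a b c : ℂ) {d e : ℂ} (hd : 0 < d.re) (he : 0 < e.re) :
    AnalyticAt ℂ (hyp32 a b c d e) 0 :=
  (geomBdd_hypCoeff a b c hd he).analyticAt_psum

/-- The solution of exponent `j/3` in `z`: `h` says that shifting `0, -2/3, -1/3` by `j/3` gives `0,
d - 1, e - 1` in some order. -/
theorem eulerOp_hyp32_comp (j : ℕ) {d e : ℂ} (hd : 0 < d.re) (he : 0 < e.re)
    (h : ∀ n : ℂ, (n + (0 + j / 3)) * (n + (-2 / 3 + j / 3)) * (n + (-1 / 3 + j / 3)) =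
      n * (n + (d - 1)) * (n + (e - 1))) :
    eulerOp qPsi Psi3 0 (-2 / 3) (-1 / 3) (-1 / 42) (5 / 42) (17 / 42)
      (fun x => cubeRootPsi x ^ j *
        hyp32 (-1 / 42 + j / 3) (5 / 42 + j / 3) (17 / 42 + j / 3) d e (Psi3 x)) =ᶠ[𝓝 0] 0 :=
  eulerOp_mul_comp _ _ _ _ _ _ analyticAt_Psi3 Psi3_zero qPsi_mul_deriv_Psi3
    (analyticAt_cubeRootPsi.pow j) (qPsi_mul_deriv_cubeRootPsi_pow j) (analyticAt_hyp32 _ _ _ hd he)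
    (eulerOp_hyp32 hd he h)

/-- The 2-jet of a power of `P₃`. -/
theorem jet_P3_cpow (c : ℂ) : Jet (fun x => P3 x ^ c) 1 (-c) (c ^ 2 - c) := by
  have hr : HasDerivAt (fun x => c * ev (lder lP) x / ev lP x) (-c) 0 := by
    have := ((hasDerivAt_ev (lder lP) 0).const_mul c).div (hasDerivAt_ev lP 0) (by simp [lP, ev])
    refine this.congr_deriv ?_
    simp [lP, lder, ladd, ev]
    ring
  have h := jet_of_deriv_eq (analyticAt_P3_cpow c)
    ((eventually_hasDerivAt_P3_cpow c).mono fun x hx => hx.deriv) hr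
  convert h using 1
  · simp [P3_zero]
  · simp [P3_zero, lP, lder, ladd, ev]
    ring
  · simp [P3_zero, lP, lder, ladd, ev]
    ring

/-- Triple vanishing at `0` makes each pulled back series equal to `1` up to third order, so only
the prefactors matter in the comparison. -/
theorem jet_Psi3 : Jet Psi3 0 0 0 := by
  have hp : AnalyticAt ℂ (fun x => ev (lmul [-7, 0, 3] (lmul [7, -7, 2] [28, -35, 11])) x ^ 3 /
      (1728 * ev lP x ^ 7)) 0 :=
    ((analyticAt_ev _ 0).pow 3).div (analyticAt_const.mul ((analyticAt_ev lP 0).pow 7))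
      (by simp [lP, ev])
  have h := (jet_id.mul (jet_id.mul jet_id)).mul ⟨hp, rfl, rfl, rfl⟩
  have e : Psi3 = fun x => x * (x * x) *
      (ev (lmul [-7, 0, 3] (lmul [7, -7, 2] [28, -35, 11])) x ^ 3 / (1728 * ev lP x ^ 7)) := by
    funext x
    rw [Psi3_eq]
    simp only [lB, ev_lmul, ev]
    push_cast
    ring
  rw [e]
  convert h using 1 <;> ring

theorem jet_cubeRootPsi : Jet cubeRootPsi 0 1 (1 / 6) := by
  -- The second derivative is left unevaluated: the factor `x` removes it from the 2-jet of the
  -- product.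
  have hQ : Jet Q3 1 (-9 / 4) (deriv (deriv Q3) 0) := by
    have h1 := ((jet_const 1).add ((jet_id.mul jet_id).const_mul (-3 / 7))).mul
      (((jet_const 1).add (jet_id.const_mul (-1))).add ((jet_id.mul jet_id).const_mul (2 / 7)))
    have h2 := h1.mul (((jet_const 1).add (jet_id.const_mul (-5 / 4))).add
      ((jet_id.mul jet_id).const_mul (11 / 28)))
    have e : Q3 = fun x : ℂ => (1 + -3 / 7 * (x * x)) * (1 + -1 * x + 2 / 7 * (x * x)) *
        (1 + -5 / 4 * x + 11 / 28 * (x * x)) := by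
      funext x; rw [Q3]; ring
    rw [← e] at h2
    refine ⟨h2.1, ?_, ?_, rfl⟩
    · rw [h2.2.1]; norm_num
    · rw [h2.2.2.1]; norm_num
  have h := (jet_id.mul hQ).mul (jet_P3_cpow (-7 / 3))
  unfold cubeRootPsi
  convert h using 1 <;> norm_num

theorem jet_hyp32_comp (a b c : ℂ) {d e : ℂ} (hd : 0 < d.re) (he : 0 < e.re) :
    Jet (fun x => hyp32 a b c d e (Psi3 x)) 1 0 0 :=
  Jet.comp ⟨analyticAt_hyp32 a b c hd he, hyp32_zero a b c d e, rfl, rfl⟩ jet_Psi3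

theorem eventually_summable_hyp32Term_Psi3 (a b c : ℂ) {d e : ℂ} (hd : 0 < d.re) (he : 0 < e.re) :
    ∀ᶠ x in 𝓝 0, Summable (hyp32Term a b c d e (Psi3 x)) := by
  have ht : Tendsto Psi3 (𝓝 0) (𝓝 0) := by
    simpa [Psi3_zero] using analyticAt_Psi3.continuousAt.tendsto
  exact (ht.eventually (geomBdd_hypCoeff a b c hd he).eventually_hasDerivAt).mono fun x hx => hx.1

/-! ### The algebraic side -/

theorem isSolution_mul_P3_cpow {T a c : List ℤ} {t Y : ℂ → ℂ} (hT : T.headD 0 ≠ 0)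
    (hsq : ∀ᶠ x in 𝓝 0, t x ^ 2 = ev T x)
    (ht : ∀ᶠ x in 𝓝 0, HasDerivAt t (ev (lder T) x * t x / (2 * ev T x)) x)
    (hY : ∀ᶠ x in 𝓝 0, HasDerivAt Y ((ev a x + ev c x * t x) / ev T x * Y x) x) :
    IsSolution T a c t fun x => Y x * P3 x ^ (-1 / 6 : ℂ) := by
  refine ⟨hT, hsq, ht, ?_⟩
  filter_upwards [hY, eventually_hasDerivAt_P3_cpow (-1 / 6), eventually_lP_ne_zero,
    eventually_ev_ne_zero hT] with x h1 h2 hP hT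
  refine (h1.mul h2).congr_deriv ?_
  field_simp
  ring

theorem hasDerivAt_ev_cpow_half {l : List ℤ} {x : ℂ} (h : ev l x ∈ Complex.slitPlane) :
    HasDerivAt (fun x => ev l x ^ (1 / 2 : ℂ))
      (ev (lder l) x * ev l x ^ (1 / 2 : ℂ) / (2 * ev l x)) x := by
  refine (hasDerivAt_cpow_const (1 / 2) (hasDerivAt_ev l x) h).congr_deriv ?_
  have := Complex.slitPlane_ne_zero h
  field_simp

theorem cpow_half_sq (z : ℂ) : (z ^ (1 / 2 : ℂ)) ^ 2 = z := by
  have := Complex.cpow_nat_inv_pow z (n := 2) two_ne_zero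
  simpa only [Nat.cast_ofNat, one_div] using this

theorem ofReal_mem_slitPlane_of_eq {z : ℂ} {r : ℝ} (h : z = r) (hr : 0 < r) :
    z ∈ Complex.slitPlane := by
  rw [h]; exact Complex.ofReal_mem_slitPlane.2 hr

theorem eventually_hasDerivAt_Y0 :
    ∀ᶠ x in 𝓝 0, HasDerivAt Y0 (-1 / (3 - 2 * x) * Y0 x) x := by
  have hu : ContinuousAt (fun x : ℂ => 1 - 2 * x / 3) 0 := by fun_prop
  filter_upwards [eventually_mem_slitPlane hu (by simp)] with x hx
  have h0 := Complex.slitPlane_ne_zero hx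
  have hd : HasDerivAt (fun x : ℂ => 1 - 2 * x / 3) (-(2 * 1 / 3)) x :=
    (((hasDerivAt_id x).const_mul 2).div_const 3).const_sub 1
  refine (hasDerivAt_cpow_const (1 / 2) hd hx).congr_deriv ?_
  have h1 : 3 - 2 * x ≠ 0 := by
    intro h
    exact h0 (by linear_combination h / 3)
  rw [Y0]
  congr 1
  field_simp

theorem Y0_zero : Y0 0 = 1 := by simp [Y0]

theorem jet_Y0 : Jet Y0 1 (-1 / 3) (-1 / 9) := by
  have ha : AnalyticAt ℂ Y0 0 := Complex.analyticAt_iff_eventually_differentiableAt.2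
    (eventually_hasDerivAt_Y0.mono fun x hx => hx.differentiableAt)
  have hr : HasDerivAt (fun x : ℂ => -1 / (3 - 2 * x)) (-2 / 9) 0 := by
    have := (hasDerivAt_const (0 : ℂ) (-1 : ℂ)).div
      (((hasDerivAt_id (0 : ℂ)).const_mul 2).const_sub 3) (by simp)
    refine this.congr_deriv ?_
    norm_num
  have h := jet_of_deriv_eq ha (eventually_hasDerivAt_Y0.mono fun x hx => hx.deriv) hr
  rw [Y0_zero] at h
  convert h using 1 <;> norm_num

theorem isSolution_Y0 : IsSolution [3, -2] [-1] [] (fun x => ev [3, -2] x ^ (1 / 2 : ℂ))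
    fun x => Y0 x * P3 x ^ (-1 / 6 : ℂ) := by
  refine isSolution_mul_P3_cpow (by decide) (Eventually.of_forall fun x => cpow_half_sq _) ?_ ?_
  · have h3 : ev [3, -2] 0 ∈ Complex.slitPlane :=
      ofReal_mem_slitPlane_of_eq (r := 3) (by simp [ev]) (by norm_num)
    exact (eventually_mem_slitPlane (analyticAt_ev _ 0).continuousAt h3).mono fun x hx =>
      hasDerivAt_ev_cpow_half hx
  · filter_upwards [eventually_hasDerivAt_Y0] with x hx
    refine hx.congr_deriv ?_
    have : ev [3, -2] x = 3 - 2 * x := by simp only [ev]; push_cast; ring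
    rw [this]
    simp [ev]

/-- Coefficients of `4 x⁴ - 21 x² + 28`, four times the radicand of `S`. -/
def lT : List ℤ := [28, 0, -21, 0, 4]

theorem S_radicand_eq (x : ℂ) : 7 - 21 / 4 * x ^ 2 + x ^ 4 = ev lT x / 4 := by
  simp only [lT, ev]
  push_cast
  ring

theorem S_sq (x : ℂ) : S x ^ 2 = ev lT x / 4 := by
  rw [S, cpow_half_sq, S_radicand_eq]

theorem S_zero : S 0 = sqrt7 := by
  rw [S, sqrt7, Real.sqrt_eq_rpow, Complex.ofReal_cpow (by norm_num)]
  norm_num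

theorem sqrt7_sq : sqrt7 ^ 2 = 7 := by
  rw [← S_zero, S_sq]
  simp [lT, ev]
  norm_num

theorem eventually_hasDerivAt_S :
    ∀ᶠ x in 𝓝 0, HasDerivAt S (ev (lder lT) x * S x / (2 * ev lT x)) x := by
  have hS : S = fun x => (ev lT x / 4) ^ (1 / 2 : ℂ) := by
    funext x
    rw [S, S_radicand_eq]
  have h7 : ev lT 0 / 4 ∈ Complex.slitPlane :=
    ofReal_mem_slitPlane_of_eq (r := 7) (by simp [lT, ev]; norm_num) (by norm_num)
  filter_upwards [eventually_mem_slitPlane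
    ((analyticAt_ev lT 0).continuousAt.div_const 4) h7] with x hx
  have h0 : ev lT x ≠ 0 := fun h => Complex.slitPlane_ne_zero hx (by simp [h])
  rw [hS]
  refine (hasDerivAt_cpow_const (1 / 2) ((hasDerivAt_ev lT x).div_const 4) hx).congr_deriv ?_
  field_simp

/-- The fourth root `((21 - 8x² + 4t) / (21 + 4t₀)) ^ (1/4)` for a branch `t` of `√T`. -/
def rootFn (t : ℂ → ℂ) (x : ℂ) : ℂ := ((21 - 8 * x ^ 2 + 4 * t x) / (21 + 4 * t 0)) ^ (1 / 4 : ℂ)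

/-- For `u = 21 - 8x² + 4t` one has `t' = -x (21 - 8x²) / t`, hence `u' = -4x u / t`; the fourth
root has logarithmic derivative `-x / t = -x t / T`. -/
theorem eventually_hasDerivAt_rootFn {t : ℂ → ℂ} (hsq : ∀ x, t x ^ 2 = ev lT x)
    (ht : ∀ᶠ x in 𝓝 0, HasDerivAt t (ev (lder lT) x * t x / (2 * ev lT x)) x) :
    ∀ᶠ x in 𝓝 0, HasDerivAt (rootFn t)
      ((ev [] x + ev [0, -1] x * t x) / ev lT x * rootFn t x) x := by
  have h0 : 21 + 4 * t 0 ≠ 0 := by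
    intro h
    have h1 := hsq 0
    simp only [lT, ev] at h1
    push_cast at h1
    -- Since `T = 28` at `0`, multiplying by the conjugate gives `16 · 28 - 21² = 7`.
    have : (7 : ℂ) = 0 := by linear_combination (4 * t 0 - 21) * h - 16 * h1
    norm_num at this
  have hc : ContinuousAt (fun x => (21 - 8 * x ^ 2 + 4 * t x) / (21 + 4 * t 0)) 0 := by
    have := ht.self_of_nhds.continuousAt
    fun_prop
  filter_upwards [ht, eventually_ev_ne_zero (l := lT) (by decide),
    eventually_mem_slitPlane hc (by simp [div_self h0])] with x hx hT hU
  have hTd : ev (lder lT) x = -42 * x + 16 * x ^ 3 := by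
    simp only [lT, lder, ladd, ev]; push_cast; ring
  have hd := (((((hasDerivAt_pow 2 x).const_mul 8).const_sub 21).add
    (hx.const_mul 4)).div_const (21 + 4 * t 0))
  refine (hasDerivAt_cpow_const (1 / 4) hd hU).congr_deriv ?_
  have hU0 : 21 - 8 * x ^ 2 + 4 * t x ≠ 0 := fun h =>
    Complex.slitPlane_ne_zero hU (by simp [h])
  rw [rootFn]
  congr 1
  have hs := hsq x
  simp only [ev, hTd] at hs ⊢
  push_cast
  have ht0 : t x ≠ 0 := by
    intro h
    rw [h] at hs
    exact hT (by simpa using hs.symm)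
  rw [← hs] at hT ⊢
  simp only [Pi.add_apply]
  field_simp
  ring

theorem analyticAt_of_eventually_hasDerivAt {f f' : ℂ → ℂ}
    (h : ∀ᶠ x in 𝓝 0, HasDerivAt f (f' x) x) : AnalyticAt ℂ f 0 :=
  Complex.analyticAt_iff_eventually_differentiableAt.2 (h.mono fun _ hx => hx.differentiableAt)

theorem jet_rootFn {t : ℂ → ℂ} (hsq : ∀ x, t x ^ 2 = ev lT x)
    (ht : ∀ᶠ x in 𝓝 0, HasDerivAt t (ev (lder lT) x * t x / (2 * ev lT x)) x)
    (h0 : 21 + 4 * t 0 ≠ 0) : Jet (rootFn t) 1 0 (-t 0 / 28) := by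
  have hd := eventually_hasDerivAt_rootFn hsq ht
  have hr : HasDerivAt (fun x => (ev [] x + ev [0, -1] x * t x) / ev lT x) (-t 0 / 28) 0 := by
    have := ((hasDerivAt_ev [] 0).add ((hasDerivAt_ev [0, -1] 0).mul ht.self_of_nhds)).div
      (hasDerivAt_ev lT 0) (by simp [lT, ev])
    refine this.congr_deriv ?_
    simp [lT, lder, ladd, ev]
    ring
  have h := jet_of_deriv_eq (analyticAt_of_eventually_hasDerivAt hd)
    (hd.mono fun x hx => hx.deriv) hr
  have h1 : rootFn t 0 = 1 := by simp [rootFn, div_self h0]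
  rw [h1] at h
  convert h using 1 <;> simp [ev]

theorem Y1_eq : Y1 = rootFn fun x => 2 * S x := by
  funext x
  simp only [Y1, rootFn, S_zero]
  ring_nf

theorem Y2_eq : Y2 = rootFn fun x => -2 * S x := by
  funext x
  simp only [Y2, rootFn, S_zero]
  ring_nf

theorem mul_S_sq {k : ℂ} (hk : k ^ 2 = 4) (x : ℂ) : (k * S x) ^ 2 = ev lT x := by
  rw [mul_pow, hk, S_sq]
  ring

theorem eventually_hasDerivAt_mul_S (k : ℂ) : ∀ᶠ x in 𝓝 0,
    HasDerivAt (fun x => k * S x) (ev (lder lT) x * (k * S x) / (2 * ev lT x)) x :=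
  eventually_hasDerivAt_S.mono fun x hx => (hx.const_mul k).congr_deriv (by ring)

theorem isSolution_rootFn {k : ℂ} (hk : k ^ 2 = 4) :
    IsSolution lT [] [0, -1] (fun x => k * S x)
      fun x => rootFn (fun x => k * S x) x * P3 x ^ (-1 / 6 : ℂ) :=
  isSolution_mul_P3_cpow (by decide) (Eventually.of_forall (mul_S_sq hk))
    (eventually_hasDerivAt_mul_S k)
    (eventually_hasDerivAt_rootFn (mul_S_sq hk) (eventually_hasDerivAt_mul_S k))

theorem jet_rootFn_mul_S {k : ℂ} (hk : k ^ 2 = 4) :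
    Jet (rootFn fun x => k * S x) 1 0 (-(k * sqrt7) / 28) := by
  have h0 : 21 + 4 * (k * S 0) ≠ 0 := by
    rw [S_zero]
    intro h
    have : (7 : ℂ) = 0 := by
      linear_combination (4 * (k * sqrt7) - 21) * h - 16 * k ^ 2 * sqrt7_sq - 112 * hk
    norm_num at this
  have h := jet_rootFn (mul_S_sq hk) (eventually_hasDerivAt_mul_S k) h0
  rwa [S_zero] at h

/-! ### Comparison of the two sides -/

/-- A solution of the pulled back equation is determined by its 2-jet as a combination of the
three algebraic solutions. -/
theorem eq_combination_of_jet {f : ℂ → ℂ} {j0 j1 j2 : ℂ} (hf : Jet f j0 j1 j2)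
    (H : eulerOp qPsi Psi3 0 (-2 / 3) (-1 / 3) (-1 / 42) (5 / 42) (17 / 42) f =ᶠ[𝓝 0] 0)
    (c0 c1 c2 : ℂ) (h0 : j0 = c0 + c1 + c2) (h1 : j1 = -c0 / 6 + (c1 + c2) / 6)
    (h2 : j2 = -c0 / 36 + 7 / 36 * (c1 + c2) + sqrt7 / 14 * (c2 - c1)) :
    ∀ᶠ x in 𝓝 0, P3 x ^ (1 / 6 : ℂ) * f x = c0 * Y0 x + c1 * Y1 x + c2 * Y2 x := by
  have k1 : (2 : ℂ) ^ 2 = 4 := by norm_num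
  have k2 : (-2 : ℂ) ^ 2 = 4 := by norm_num
  have J0 := jet_Y0.mul (jet_P3_cpow (-1 / 6))
  have J1 := (jet_rootFn_mul_S k1).mul (jet_P3_cpow (-1 / 6))
  have J2 := (jet_rootFn_mul_S k2).mul (jet_P3_cpow (-1 / 6))
  have E0 := isSolution_Y0.eulerOp_eq_zero cert_Y0
  have E1 := (isSolution_rootFn k1).eulerOp_eq_zero cert_Y1
  have E2 := (isSolution_rootFn k2).eulerOp_eq_zero cert_Y1
  rw [← Y1_eq] at J1 E1
  rw [← Y2_eq] at J2 E2
  -- Subtract the proposed combination term by term, tracking both the jet and the equation; `h0`,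
  -- `h1`, `h2` say exactly that the resulting 2-jet is zero.
  have A1 := hf.add (J0.const_mul (-c0))
  have A2 := A1.add (J1.const_mul (-c1))
  have A3 := A2.add (J2.const_mul (-c2))
  have B1 := eulerOp_add_const_mul analyticAt_qPsi Psi3 _ _ _ _ _ _ (-c0) hf.1 J0.1 H E0
  have B2 := eulerOp_add_const_mul analyticAt_qPsi Psi3 _ _ _ _ _ _ (-c1) A1.1 J1.1 B1 E1
  have B3 := eulerOp_add_const_mul analyticAt_qPsi Psi3 _ _ _ _ _ _ (-c2) A2.1 J2.1 B2 E2
  have A := A3.congr (a' := 0) (b' := 0) (c' := 0) (by rw [h0]; ring) (by rw [h1]; ring)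
    (by rw [h2]; ring)
  have hz := eventually_eq_zero_of_eulerOp (Eventually.of_forall qPsi_eq) analyticAt_qPsi_div
    (by simp only [lK, lP, ev_lmul, ev]; norm_num) analyticAt_Psi3.continuousAt Psi3_zero A B3
  filter_upwards [hz, eventually_lP_ne_zero] with x hx hP
  have hP3 : P3 x ≠ 0 := by rw [P3_eq]; exact div_ne_zero hP (by norm_num)
  have hinv : P3 x ^ (1 / 6 : ℂ) * P3 x ^ (-1 / 6 : ℂ) = 1 := by
    rw [← Complex.cpow_add _ _ hP3]
    norm_num
  simp only [Pi.zero_apply] at hx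
  linear_combination P3 x ^ (1 / 6 : ℂ) * hx + (c0 * Y0 x + c1 * Y1 x + c2 * Y2 x) * hinv

theorem P3_cpow_mul_cubeRootPsi {x : ℂ} (hP : ev lP x ≠ 0) :
    P3 x ^ (1 / 6 : ℂ) * cubeRootPsi x = x * Q3 x * P3 x ^ (-13 / 6 : ℂ) := by
  have hP3 : P3 x ≠ 0 := by rw [P3_eq]; exact div_ne_zero hP (by norm_num)
  have e : (-13 / 6 : ℂ) = 1 / 6 + -7 / 3 := by norm_num
  rw [e, Complex.cpow_add _ _ hP3, cubeRootPsi]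
  ring

theorem P3_cpow_mul_cubeRootPsi_sq {x : ℂ} (hP : ev lP x ≠ 0) :
    P3 x ^ (1 / 6 : ℂ) * cubeRootPsi x ^ 2 = x ^ 2 * Q3 x ^ 2 * P3 x ^ (-9 / 2 : ℂ) := by
  have hP3 : P3 x ≠ 0 := by rw [P3_eq]; exact div_ne_zero hP (by norm_num)
  have e : (-9 / 2 : ℂ) = 1 / 6 + -7 / 3 + -7 / 3 := by norm_num
  rw [e, Complex.cpow_add _ _ hP3, Complex.cpow_add _ _ hP3, cubeRootPsi]
  ring

end DihedralEval

end

theorem mainTheorem1 :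
    ∀ᶠ x : ℂ in 𝓝 0,
      (Summable (DihedralEval.hyp32Term (-1 / 42) (5 / 42) (17 / 42) (1 / 3) (2 / 3)
          (DihedralEval.Psi3 x)) ∧
        DihedralEval.P3 x ^ (1 / 6 : ℂ) *
            DihedralEval.hyp32 (-1 / 42) (5 / 42) (17 / 42) (1 / 3) (2 / 3)
              (DihedralEval.Psi3 x) =
          1 / 2 * DihedralEval.Y0 x
            + (3 + DihedralEval.sqrt7) / 12 * DihedralEval.Y1 x
            + (3 - DihedralEval.sqrt7) / 12 * DihedralEval.Y2 x) ∧
      (Summable (DihedralEval.hyp32Term (13 / 42) (19 / 42) (31 / 42) (2 / 3) (4 / 3)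
          (DihedralEval.Psi3 x)) ∧
        x * DihedralEval.Q3 x * DihedralEval.P3 x ^ (-13 / 6 : ℂ) *
            DihedralEval.hyp32 (13 / 42) (19 / 42) (31 / 42) (2 / 3) (4 / 3)
              (DihedralEval.Psi3 x) =
          -3 * DihedralEval.Y0 x
            + (3 + DihedralEval.sqrt7) / 2 * DihedralEval.Y1 x
            + (3 - DihedralEval.sqrt7) / 2 * DihedralEval.Y2 x) ∧
      (Summable (DihedralEval.hyp32Term (9 / 14) (11 / 14) (15 / 14) (4 / 3) (5 / 3)
          (DihedralEval.Psi3 x)) ∧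
        x ^ 2 * DihedralEval.Q3 x ^ 2 * DihedralEval.P3 x ^ (-9 / 2 : ℂ) *
            DihedralEval.hyp32 (9 / 14) (11 / 14) (15 / 14) (4 / 3) (5 / 3)
              (DihedralEval.Psi3 x) =
          -2 * DihedralEval.sqrt7 * DihedralEval.Y1 x
            + 2 * DihedralEval.sqrt7 * DihedralEval.Y2 x) := by
  have r1 : 0 < (1 / 3 : ℂ).re := by norm_num
  have r2 : 0 < (2 / 3 : ℂ).re := by norm_num
  have r4 : 0 < (4 / 3 : ℂ).re := by norm_num
  have r5 : 0 < (5 / 3 : ℂ).re := by norm_num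
  have hs := DihedralEval.sqrt7_sq
  have E0 := DihedralEval.eulerOp_hyp32_comp 0 r1 r2 (fun n => by push_cast; ring)
  have E1 := DihedralEval.eulerOp_hyp32_comp 1 r2 r4 (fun n => by push_cast; ring)
  have E2 := DihedralEval.eulerOp_hyp32_comp 2 r4 r5 (fun n => by push_cast; ring)
  have J0 := DihedralEval.jet_hyp32_comp (-1 / 42) (5 / 42) (17 / 42) r1 r2
  have J1 := DihedralEval.jet_cubeRootPsi.mul
    (DihedralEval.jet_hyp32_comp (13 / 42) (19 / 42) (31 / 42) r2 r4)
  have J2 := (DihedralEval.jet_cubeRootPsi.mul DihedralEval.jet_cubeRootPsi).mul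
    (DihedralEval.jet_hyp32_comp (9 / 14) (11 / 14) (15 / 14) r4 r5)
  norm_num only [pow_zero, one_mul, pow_one, Nat.cast_ofNat, Nat.cast_zero, Nat.cast_one] at E0 E1 E2
  norm_num only at J1 J2
  simp only [← pow_two] at J2
  -- The 2-jets are `(1, 0, 0)`, `(0, 1, 1/6)` and `(0, 0, 2)`; the coefficients solve the three jet
  -- equations, the last one using `√7² = 7`.
  have F0 := DihedralEval.eq_combination_of_jet J0 (by convert E0 using 2 <;> norm_num)
    (1 / 2) ((3 + DihedralEval.sqrt7) / 12) ((3 - DihedralEval.sqrt7) / 12)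
    (by ring) (by ring) (by linear_combination (1 / 84) * hs)
  have F1 := DihedralEval.eq_combination_of_jet J1 (by convert E1 using 2 <;> norm_num)
    (-3) ((3 + DihedralEval.sqrt7) / 2) ((3 - DihedralEval.sqrt7) / 2)
    (by ring) (by ring) (by linear_combination (1 / 14) * hs)
  have F2 := DihedralEval.eq_combination_of_jet J2 (by convert E2 using 2 <;> norm_num)
    0 (-2 * DihedralEval.sqrt7) (2 * DihedralEval.sqrt7)
    (by ring) (by ring) (by linear_combination (-2 / 7) * hs)
  filter_upwards [F0, F1, F2, DihedralEval.eventually_lP_ne_zero,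
    DihedralEval.eventually_summable_hyp32Term_Psi3 (-1 / 42) (5 / 42) (17 / 42) r1 r2,
    DihedralEval.eventually_summable_hyp32Term_Psi3 (13 / 42) (19 / 42) (31 / 42) r2 r4,
    DihedralEval.eventually_summable_hyp32Term_Psi3 (9 / 14) (11 / 14) (15 / 14) r4 r5]
    with x f0 f1 f2 hP s0 s1 s2
  refine ⟨⟨s0, f0⟩, ⟨s1, ?_⟩, ⟨s2, ?_⟩⟩
  · rw [← DihedralEval.P3_cpow_mul_cubeRootPsi hP, mul_assoc, f1]
  · rw [← DihedralEval.P3_cpow_mul_cubeRootPsi_sq hP, mul_assoc, f2]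
    ring
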